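/- Let $\{a_n\}_{n\ge 0}$ be a sequence of real numbers such that, as $n\to\infty$ (in particular $a_n\neq 0$ for all large $n$), \[ u_n=\frac{a_{n-1}a_{n+1}}{a_n^2}=1+\sum_{i=1}^m\frac{r_i(\log n)}{n^{\alpha_i}}+o\left(\frac1{n^{\beta}}\right), \] where $m\ge 1$ is an integer, $r_1(x),\ldots,r_m(x)$ are rational functions of $x$ with real coefficients, and $\alpha_1,\ldots,\alpha_m,\beta$ are real numbers with $0<\alpha_1<\alpha_2<\cdots<\alpha_m<\beta$. Put $\ell=\lfloor \alpha_m/\alpha_1\rfloor$. Suppose that either (i) $0<\alpha_1<2$ and $r_1(x)<0$ for all sufficiently large real $x$, or (ii) $\alpha_1=2$ and $r_1(x)<-2+\dfrac{1}{2^{\ell-2}}$ for all sufficiently large real $x$. Then $\{a_n\}_{n\ge 0}$ is asymptotically $\ell$-log-concave: writing $\varphi\{a_n\}_{n\ge 0}=\{a_{n+1}^2-a_na_{n+2}\}_{n\ge 0}$ and $\varphi^k$ for the $k$-fold iterate of $\varphi$, there is an integer $N$ such that for every $1\le k\le \ell$ all terms of the sequence $\varphi^k\{a_n\}_{n\ge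 0}$ with index $n\ge N$ are nonnegative. -/

import Mathlib

open Filter Asymptotics

noncomputable section

/-- The operator `φ` sending `(a n)` to `(a (n+1) ^ 2 - a n * a (n+2))`. -/
def logOp (a : ℕ → ℝ) : ℕ → ℝ := fun n => a (n + 1) ^ 2 - a n * a (n + 2)

/-- `ℓ`-log-concavity: `φ a, φ² a, …, φ^ℓ a` are all nonnegative sequences. -/
def IsLogConcaveSeq (ℓ : ℕ) (a : ℕ → ℝ) : Prop :=
  ∀ k : ℕ, 1 ≤ k → k ≤ ℓ → ∀ n : ℕ, 0 ≤ (logOp^[k] a) n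

/-- Asymptotic `ℓ`-log-concavity: some tail `(a n)_{n ≥ N}` is `ℓ`-log-concave. -/
def IsAsympLogConcaveSeq (ℓ : ℕ) (a : ℕ → ℝ) : Prop :=
  ∃ N : ℕ, IsLogConcaveSeq ℓ (fun n => a (N + n))

/-- The ratio `u n = a (n-1) * a (n+1) / a n ^ 2`; only the values for large `n` matter. -/
def turanRatio (a : ℕ → ℝ) (n : ℕ) : ℝ := a (n - 1) * a (n + 1) / a n ^ 2

/-- The value of a real rational function at a real point (which is not a pole). -/
def ratVal (r : RatFunc ℝ) (x : ℝ) : ℝ := r.eval (RingHom.id ℝ) x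

/-- `u n = 1 + ∑ i, r i (log n) / n ^ (α i) + o(1 / n ^ β)` with
`0 < α 0 < α 1 < ⋯ < α m < β`; there are `m + 1` terms, indexed from `0`. -/
structure HasRatioExpansion (a : ℕ → ℝ) {m : ℕ} (α : Fin (m + 1) → ℝ)
    (r : Fin (m + 1) → RatFunc ℝ) (β : ℝ) : Prop where
  pos : 0 < α 0
  strictMono : StrictMono α
  last_lt : α (Fin.last m) < β
  isLittleO :
    (fun n : ℕ => turanRatio a n -
        (1 + ∑ i, ratVal (r i) (Real.log (n : ℝ)) / (n : ℝ) ^ (α i)))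
      =o[atTop] (fun n : ℕ => 1 / (n : ℝ) ^ β)

end

/-! Write `f n = 1 - shiftRatio a n`, that is `1 - u (n + 1)`. Since `logOp a n = a (n + 1) ^ 2 * f
n`, positivity of `φ a` is positivity of `f`, and `φ` acts on `f` by `ratioStep`, which sends `f` to
approximately `2 f - (shiftRatio f - 1)` (`one_sub_shiftRatio_logOp`,
`PosOrder.ratioStep_hasOrder`). It suffices that the first `ℓ` iterates of `f`, starting with `f`
itself, are eventually positive.

The explicit part `F` of `f`, with leading term `-r 0 (log n) / n ^ α 0`, is a symbol: each
difference gains a factor `1 / n`, so `shiftRatio F - 1` has order `-2`. If `α 0 < 2` this is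
negligible and each step doubles the leading term. If `α 0 = 2`, then `shiftRatio` of `n ^ (-2)` is
about `1 + 2 / n ^ 2`, and the coefficient `c = -r 0` evolves by `c ↦ 2 c - 2`. Thus `c - 2`
doubles, and `c > 2 - γ` with `γ = 2 ^ (2 - ℓ)` keeps the `k`-th coefficient above `2 - 2 ^ k * γ ≥
0` for `k < ℓ`. The excess over this bound may decay like a power of `log n`, so the corrections
caused by the slow variation of `c` must be shown to be smaller by a factor `1 / log n`; `logWeight`
measures them.

The error `o(n ^ (-β))` has controlled size but uncontrolled differences. Each step costs it a
factor `n ^ α 0` (`ratioStep_sub_hasOrder`), which is affordable because `ℓ * α 0 ≤ α m < β`.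
`isAsympLogConcaveSeq_of_posOrder` combines the two estimates. -/

open scoped fwdDiff

/-! ### Calculus of symbols. -/

/-- `e` is a symbol of weight `w` up to order `j`: its iterated forward differences satisfy
`Δ^i e = O(w / n^i)` for all `i ≤ j`. -/
def IsSymbol : ℕ → (ℕ → ℝ) → (ℕ → ℝ) → Prop
  | 0, w, e => e =O[atTop] w
  | j + 1, w, e => e =O[atTop] w ∧ IsSymbol j (fun n => w n / n) (Δ_[1] e)

namespace IsSymbol

variable {j : ℕ} {w v e f : ℕ → ℝ}

theorem isBigO (h : IsSymbol j w e) : e =O[atTop] w := by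
  cases j with
  | zero => exact h
  | succ j => exact h.1

theorem mono_weight (h : IsSymbol j w e) (hw : w =O[atTop] v) : IsSymbol j v e := by
  induction j generalizing w v e with
  | zero => exact IsBigO.trans h hw
  | succ j ih =>
    refine ⟨h.1.trans hw, ih h.2 ?_⟩
    simpa only [div_eq_mul_inv] using hw.mul (isBigO_refl (fun n : ℕ => (n : ℝ)⁻¹) atTop)

theorem div_natCast_isBigO (w : ℕ → ℝ) : (fun n : ℕ => w n / n) =O[atTop] w := by
  refine IsBigO.of_bound 1 ?_
  filter_upwards [eventually_ge_atTop 1] with n hn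
  have : (1 : ℝ) ≤ n := by exact_mod_cast hn
  rw [norm_div, one_mul, Real.norm_natCast]
  exact div_le_self (norm_nonneg _) this

theorem of_succ (h : IsSymbol (j + 1) w e) : IsSymbol j w e := by
  induction j generalizing w e with
  | zero => exact h.1
  | succ j ih => exact ⟨h.1, ih h.2⟩

theorem fwdDiff (h : IsSymbol (j + 1) w e) : IsSymbol j (fun n => w n / n) (Δ_[1] e) := h.2

theorem congr (h : IsSymbol j w e) (hef : e =ᶠ[atTop] f) : IsSymbol j w f := by
  induction j generalizing w e f with
  | zero => exact IsBigO.congr' h hef EventuallyEq.rfl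
  | succ j ih =>
    refine ⟨h.1.congr' hef EventuallyEq.rfl, ih h.2 ?_⟩
    filter_upwards [hef, (tendsto_add_atTop_nat 1).eventually hef] with n h0 h1
    simp only [_root_.fwdDiff, h0, h1]

theorem zero : IsSymbol j w (fun _ => 0) := by
  induction j generalizing w with
  | zero => exact isBigO_zero _ _
  | succ j ih =>
    refine ⟨isBigO_zero _ _, ?_⟩
    have : Δ_[1] (fun _ : ℕ => (0 : ℝ)) = fun _ => 0 := by ext n; simp [_root_.fwdDiff]
    rw [this]
    exact ih

theorem const (c : ℝ) : IsSymbol j (fun _ => 1) (fun _ => c) := by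
  cases j with
  | zero => exact isBigO_const_const c one_ne_zero _
  | succ j =>
    refine ⟨isBigO_const_const c one_ne_zero _, ?_⟩
    have : Δ_[1] (fun _ : ℕ => c) = fun _ => 0 := by ext n; simp [_root_.fwdDiff]
    rw [this]
    exact zero

theorem add (he : IsSymbol j w e) (hf : IsSymbol j w f) : IsSymbol j w (fun n => e n + f n) := by
  induction j generalizing w e f with
  | zero => exact IsBigO.add he hf
  | succ j ih =>
    refine ⟨he.1.add hf.1, (ih he.2 hf.2).congr (.of_eq ?_)⟩
    ext n
    simp only [_root_.fwdDiff]
    ring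

theorem mul (he : IsSymbol j w e) (hf : IsSymbol j v f) :
    IsSymbol j (fun n => w n * v n) (fun n => e n * f n) := by
  induction j generalizing w v e f with
  | zero => exact IsBigO.mul he hf
  | succ j ih =>
    refine ⟨he.1.mul hf.1, ?_⟩
    -- Discrete Leibniz rule: `Δ(ef) = Δe · f + e · Δf + Δe · Δf`.
    have h1 := ih he.2 hf.of_succ
    have h2 := ih he.of_succ hf.2
    have h3 := ih he.2 (hf.2.mono_weight (div_natCast_isBigO v))
    have h2' : IsSymbol j (fun n => w n / n * v n) (fun n => e n * Δ_[1] f n) := by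
      convert h2 using 2
      ring
    convert ((h1.add h2').add h3).congr (f := Δ_[1] fun n => e n * f n) (.of_eq ?_) using 2
    · ring
    · ext n
      simp only [_root_.fwdDiff]
      ring

theorem const_mul (c : ℝ) (he : IsSymbol j w e) : IsSymbol j w (fun n => c * e n) := by
  simpa using (const (j := j) c).mul he

theorem neg (he : IsSymbol j w e) : IsSymbol j w (fun n => -e n) := by
  simpa using he.const_mul (-1)

theorem sub (he : IsSymbol j w e) (hf : IsSymbol j w f) : IsSymbol j w (fun n => e n - f n) := by
  simpa only [sub_eq_add_neg] using he.add hf.neg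

theorem sum {ι : Type*} (s : Finset ι) {e : ι → ℕ → ℝ} (h : ∀ i ∈ s, IsSymbol j w (e i)) :
    IsSymbol j w (fun n => ∑ i ∈ s, e i n) := by
  classical
  induction s using Finset.induction_on with
  | empty => simpa using zero
  | insert i s hi ih =>
    simp only [Finset.sum_insert hi]
    exact (h i (by simp)).add (ih fun k hk => h k (by simp [hk]))

theorem shift (h : IsSymbol (j + 1) w e) : IsSymbol j w (fun n => e (n + 1)) := by
  refine (h.of_succ.add (h.2.mono_weight (div_natCast_isBigO w))).congr (.of_eq ?_)
  ext n
  simp only [_root_.fwdDiff]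
  ring

/-- Reciprocals of symbols. The two weights `w` and `u` bound `e` and `e⁻¹` respectively. -/
theorem inv {u : ℕ → ℝ} (he : IsSymbol j w e) (h0 : ∀ᶠ n in atTop, e n ≠ 0)
    (hu : (fun n => (e n)⁻¹) =O[atTop] u) (hs : (fun n => u (n + 1)) =O[atTop] u)
    (hwu : ∀ᶠ n in atTop, 1 ≤ w n * u n) :
    IsSymbol j (fun n => u n * (w n * u n) ^ (2 ^ j - 1)) (fun n => (e n)⁻¹) := by
  have key : ∀ k : ℕ, u =O[atTop] fun n => u n * (w n * u n) ^ k := by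
    intro k
    refine IsBigO.of_bound 1 ?_
    filter_upwards [hwu] with n hn
    rw [one_mul, norm_mul]
    refine le_mul_of_one_le_right (norm_nonneg _) ?_
    exact (one_le_pow₀ hn).trans (le_abs_self _)
  induction j generalizing e with
  | zero => exact hu.trans (key _)
  | succ j ih =>
    refine ⟨hu.trans (key _), ?_⟩
    have hu' := (hu.comp_tendsto (tendsto_add_atTop_nat 1)).trans hs
    have h1 := ih he.of_succ h0 hu
    have h2 := ih he.shift ((tendsto_add_atTop_nat 1).eventually h0) hu'
    -- `Δ(1/e)(n) = -Δe(n) / (e(n) e(n+1))`: two reciprocals and one further factor `w`, so the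
    -- exponent `N` of `w * u` becomes `2 N + 1`.
    refine (((he.2.neg.mul h1).mul h2).mono_weight (EventuallyEq.isBigO (.of_eq ?_))).congr ?_
    · ext n
      have : 2 ^ (j + 1) - 1 = (2 ^ j - 1) + (2 ^ j - 1) + 1 := by
        have := Nat.one_le_two_pow (n := j)
        omega
      rw [this]
      ring
    · filter_upwards [h0, (tendsto_add_atTop_nat 1).eventually h0] with n a b
      simp only [_root_.fwdDiff]
      field_simp
      ring

end IsSymbol

/-! ### Orders up to `n ^ ε`, where powers of `log n` are invisible. -/

/-- `e` is a symbol of order at most `ρ + ε`, for every `ε > 0`, up to `j` differences. -/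
def HasOrder (j : ℕ) (ρ : ℝ) (e : ℕ → ℝ) : Prop :=
  ∀ ε > 0, IsSymbol j (fun n => (n : ℝ) ^ (ρ + ε)) e

theorem natCast_rpow_isBigO {ρ σ : ℝ} (h : ρ ≤ σ) :
    (fun n : ℕ => (n : ℝ) ^ ρ) =O[atTop] fun n : ℕ => (n : ℝ) ^ σ := by
  refine IsBigO.of_bound 1 ?_
  filter_upwards [eventually_ge_atTop 1] with n hn
  have : (1 : ℝ) ≤ n := by exact_mod_cast hn
  rw [one_mul, Real.norm_of_nonneg (by positivity), Real.norm_of_nonneg (by positivity)]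
  exact Real.rpow_le_rpow_of_exponent_le this h

theorem rpow_le_two_rpow_abs_mul_rpow {x y : ℝ} (ρ : ℝ) (hx : 0 < x) (hxy : x ≤ y)
    (hy : y ≤ 2 * x) : y ^ ρ ≤ 2 ^ |ρ| * x ^ ρ := by
  have h2 : y ^ ρ = (y / x) ^ ρ * x ^ ρ := by
    rw [← Real.mul_rpow (div_nonneg (hx.le.trans hxy) hx.le) hx.le]
    congr 1
    field_simp
  rw [h2]
  refine mul_le_mul_of_nonneg_right ?_ (by positivity)
  have h3 : 1 ≤ y / x := by rwa [one_le_div hx]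
  calc (y / x) ^ ρ ≤ (y / x) ^ |ρ| := Real.rpow_le_rpow_of_exponent_le h3 (le_abs_self ρ)
    _ ≤ 2 ^ |ρ| := Real.rpow_le_rpow (by linarith) (by rwa [div_le_iff₀ hx]) (abs_nonneg _)

theorem natCast_succ_rpow_isBigO (ρ : ℝ) :
    (fun n : ℕ => ((n + 1 : ℕ) : ℝ) ^ ρ) =O[atTop] fun n : ℕ => (n : ℝ) ^ ρ := by
  refine IsBigO.of_bound (2 ^ |ρ|) ?_
  filter_upwards [eventually_ge_atTop 1] with n hn
  have h1 : (1 : ℝ) ≤ n := by exact_mod_cast hn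
  rw [Real.norm_of_nonneg (by positivity), Real.norm_of_nonneg (by positivity)]
  push_cast
  exact rpow_le_two_rpow_abs_mul_rpow ρ (by linarith) (by linarith) (by linarith)

namespace HasOrder

variable {j : ℕ} {ρ σ : ℝ} {e f : ℕ → ℝ}

theorem mono (h : HasOrder j ρ e) (hρ : ρ ≤ σ) : HasOrder j σ e := fun ε hε =>
  (h ε hε).mono_weight (natCast_rpow_isBigO (by linarith))

theorem congr (h : HasOrder j ρ e) (hef : e =ᶠ[atTop] f) : HasOrder j ρ f := fun ε hε =>
  (h ε hε).congr hef

theorem add (he : HasOrder j ρ e) (hf : HasOrder j ρ f) : HasOrder j ρ (fun n => e n + f n) :=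
  fun ε hε => (he ε hε).add (hf ε hε)

theorem neg (he : HasOrder j ρ e) : HasOrder j ρ (fun n => -e n) := fun ε hε => (he ε hε).neg

theorem sub (he : HasOrder j ρ e) (hf : HasOrder j ρ f) : HasOrder j ρ (fun n => e n - f n) :=
  fun ε hε => (he ε hε).sub (hf ε hε)

theorem const_mul (c : ℝ) (he : HasOrder j ρ e) : HasOrder j ρ (fun n => c * e n) :=
  fun ε hε => (he ε hε).const_mul c

theorem sum {ι : Type*} (s : Finset ι) {e : ι → ℕ → ℝ} (h : ∀ i ∈ s, HasOrder j ρ (e i)) :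
    HasOrder j ρ (fun n => ∑ i ∈ s, e i n) := fun ε hε => .sum s fun i hi => h i hi ε hε

theorem mul (he : HasOrder j ρ e) (hf : HasOrder j σ f) :
    HasOrder j (ρ + σ) (fun n => e n * f n) := by
  intro ε hε
  refine ((he (ε / 2) (by linarith)).mul (hf (ε / 2) (by linarith))).mono_weight
    (EventuallyEq.isBigO ?_)
  filter_upwards [eventually_gt_atTop 0] with n hn
  rw [← Real.rpow_add (by exact_mod_cast hn)]
  congr 1
  ring

theorem const (c : ℝ) : HasOrder j 0 (fun _ => c) := fun ε hε =>
  (IsSymbol.const c).mono_weight <| by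
    simpa using natCast_rpow_isBigO (show (0 : ℝ) ≤ 0 + ε by linarith)

theorem mul_le {τ : ℝ} (he : HasOrder j ρ e) (hf : HasOrder j σ f) (h : ρ + σ ≤ τ) :
    HasOrder j τ (fun n => e n * f n) := (he.mul hf).mono h

theorem fwdDiff (h : HasOrder (j + 1) ρ e) : HasOrder j (ρ - 1) (Δ_[1] e) := by
  intro ε hε
  refine (h ε hε).fwdDiff.mono_weight (EventuallyEq.isBigO ?_)
  filter_upwards [eventually_gt_atTop 0] with n hn
  rw [show ρ - 1 + ε = ρ + ε - 1 by ring, Real.rpow_sub_one (by positivity)]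

theorem shift (h : HasOrder (j + 1) ρ e) : HasOrder j ρ (fun n => e (n + 1)) :=
  fun ε hε => (h ε hε).shift

theorem shift_zero (h : HasOrder 0 ρ e) : HasOrder 0 ρ (fun n => e (n + 1)) := fun ε hε =>
  (IsBigO.comp_tendsto (h ε hε) (tendsto_add_atTop_nat 1)).trans (natCast_succ_rpow_isBigO _)

theorem inv (he : HasOrder j ρ e) (h0 : ∀ᶠ n in atTop, e n ≠ 0)
    (hi : HasOrder 0 (-ρ) (fun n => (e n)⁻¹)) : HasOrder j (-ρ) (fun n => (e n)⁻¹) := by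
  intro ε hε
  set N : ℕ := 2 ^ j - 1 with hN
  -- The reciprocal has weight `u (w u) ^ N` with `u = n ^ (-ρ + η)` and `w u = n ^ (2 η)`, a total
  -- loss of `(2 N + 1) η`.
  set η : ℝ := ε / (2 * N + 1) with hη
  have hη0 : 0 < η := by positivity
  have hprod : ∀ n : ℕ, 0 < n →
      (n : ℝ) ^ (ρ + η) * (n : ℝ) ^ (-ρ + η) = (n : ℝ) ^ (2 * η) := by
    intro n hn
    rw [← Real.rpow_add (by exact_mod_cast hn)]
    congr 1
    ring
  refine ((he η hη0).inv h0 (hi η hη0) (natCast_succ_rpow_isBigO _) ?_).mono_weight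
    (EventuallyEq.isBigO ?_)
  · filter_upwards [eventually_ge_atTop 1] with n hn
    rw [hprod n hn]
    exact Real.one_le_rpow (by exact_mod_cast hn) (by positivity)
  · filter_upwards [eventually_gt_atTop 0] with n hn
    rw [hprod n hn, ← Real.rpow_mul_natCast (by positivity),
      ← Real.rpow_add (by exact_mod_cast hn)]
    congr 1
    rw [← hN, hη]
    field_simp
    ring

theorem tendsto_zero (h : HasOrder 0 ρ e) (hρ : ρ < 0) : Tendsto e atTop (nhds 0) := by
  have h1 : e =O[atTop] fun n : ℕ => (n : ℝ) ^ (ρ + -ρ / 2) := h (-ρ / 2) (by linarith)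
  refine h1.trans_tendsto ?_
  have h2 := (tendsto_rpow_neg_atTop (y := -ρ / 2) (by linarith)).comp
    (tendsto_natCast_atTop_atTop (R := ℝ))
  convert h2 using 2 with n
  simp only [Function.comp]
  congr 1
  ring

/-- A perturbation of smaller order preserves positivity and the order of the reciprocal. -/
theorem perturb (hpos : ∀ᶠ n in atTop, 0 < f n) (hi : HasOrder 0 (-ρ) (fun n => (f n)⁻¹))
    (he : HasOrder 0 σ e) (h : σ < ρ) :
    (∀ᶠ n in atTop, 0 < f n + e n) ∧ HasOrder 0 (-ρ) (fun n => (f n + e n)⁻¹) := by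
  have ht := (he.mul hi).tendsto_zero (by linarith)
  have hb : ∀ᶠ n in atTop, f n / 2 ≤ f n + e n := by
    filter_upwards [hpos, ht.eventually (lt_mem_nhds (show (-1 / 2 : ℝ) < 0 by norm_num))]
      with n h0 h1
    rw [← div_eq_mul_inv, lt_div_iff₀ h0] at h1
    linarith
  refine ⟨?_, fun ε hε => IsBigO.trans (IsBigO.of_bound 2 ?_) (hi ε hε)⟩
  · filter_upwards [hb, hpos] with n h1 h2
    linarith
  · filter_upwards [hb, hpos] with n h1 h2
    rw [norm_inv, norm_inv, Real.norm_of_nonneg (by linarith), Real.norm_of_nonneg h2.le,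
      ← div_eq_mul_inv, le_div_iff₀ h2, inv_mul_le_iff₀ (by linarith)]
    linarith

end HasOrder

/-! ### Powers and the logarithm as symbols, by the mean value theorem. -/

theorem hasDerivAt_iterate_fwdDiff {f f' : ℝ → ℝ} (h : ∀ x > 0, HasDerivAt f (f' x) x) (j : ℕ) :
    ∀ x > 0, HasDerivAt ((Δ_[1])^[j] f) ((Δ_[1])^[j] f' x) x := by
  induction j generalizing f f' with
  | zero => exact h
  | succ j ih =>
    simp only [Function.iterate_succ, Function.comp]
    exact ih fun x hx => ((h (x + 1) (by linarith)).comp_add_const x 1).sub (h x hx)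

theorem abs_fwdDiff_le_of_abs_deriv_le {g g' : ℝ → ℝ} {C σ : ℝ} (hC : 0 ≤ C)
    (h : ∀ x > 0, HasDerivAt g (g' x) x) (hb : ∀ x ≥ 1, |g' x| ≤ C * x ^ σ) :
    ∀ x ≥ 1, |Δ_[1] g x| ≤ C * 2 ^ |σ| * x ^ σ := by
  intro x hx
  obtain ⟨c, ⟨hc1, hc2⟩, hc⟩ := exists_hasDerivAt_eq_slope g g' (a := x) (b := x + 1) (by linarith)
    (fun y hy => (h y (by linarith [hy.1])).continuousAt.continuousWithinAt)
    (fun y hy => h y (by linarith [hy.1]))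
  have : Δ_[1] g x = g' c := by rw [hc, fwdDiff]; simp
  rw [this, mul_assoc]
  exact (hb c (by linarith)).trans (mul_le_mul_of_nonneg_left
    (rpow_le_two_rpow_abs_mul_rpow σ (by linarith) hc1.le (by linarith)) hC)

/-- Differences commute with differentiation, so the last difference is, by the mean value theorem,
a value of `γ Δ^j x^(γ-1)` on `(x, x + 1)`; hence the induction over all `γ`. -/
theorem exists_abs_iterate_fwdDiff_rpow_le (j : ℕ) (γ : ℝ) :
    ∃ C ≥ 0, ∀ x ≥ 1, |(Δ_[1])^[j] (fun x : ℝ => x ^ γ) x| ≤ C * x ^ (γ - j) := by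
  induction j generalizing γ with
  | zero =>
    refine ⟨1, zero_le_one, fun x hx => ?_⟩
    simp only [Function.iterate_zero, id, Nat.cast_zero, sub_zero, one_mul]
    rw [abs_of_nonneg (Real.rpow_nonneg (by linarith) _)]
  | succ j ih =>
    obtain ⟨C, hC, h⟩ := ih (γ - 1)
    refine ⟨|γ| * C * 2 ^ |γ - (j + 1 : ℕ)|, by positivity, fun x hx => ?_⟩
    rw [Function.iterate_succ_apply']
    refine abs_fwdDiff_le_of_abs_deriv_le (C := |γ| * C) (by positivity)
      (hasDerivAt_iterate_fwdDiff (f' := γ • fun x : ℝ => x ^ (γ - 1))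
        (fun x hx => Real.hasDerivAt_rpow_const (.inl hx.ne')) j) ?_ x hx
    intro y hy
    rw [fwdDiff_iter_const_smul, Pi.smul_apply, smul_eq_mul, abs_mul, mul_assoc]
    refine mul_le_mul_of_nonneg_left ((h y hy).trans_eq ?_) (abs_nonneg _)
    congr 2
    push_cast
    ring

theorem exists_abs_iterate_fwdDiff_log_le (j : ℕ) :
    ∃ C ≥ 0, ∀ x ≥ 1, |(Δ_[1])^[j] (Δ_[1] Real.log) x| ≤ C * x ^ (-1 - (j : ℝ)) := by
  obtain ⟨C, hC, h⟩ := exists_abs_iterate_fwdDiff_rpow_le j (-1)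
  refine ⟨C * 2 ^ |-1 - (j : ℝ)|, by positivity, fun x hx => ?_⟩
  rw [← Function.iterate_succ_apply, Function.iterate_succ_apply']
  refine abs_fwdDiff_le_of_abs_deriv_le hC (hasDerivAt_iterate_fwdDiff
    (f' := fun x : ℝ => x ^ (-1 : ℝ)) (fun x hx => ?_) j) h x hx
  rw [Real.rpow_neg_one]
  exact Real.hasDerivAt_log hx.ne'

theorem natCast_rpow_div (γ : ℝ) :
    (fun n : ℕ => (n : ℝ) ^ γ / n) =ᶠ[atTop] fun n : ℕ => (n : ℝ) ^ (γ - 1) := by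
  filter_upwards [eventually_gt_atTop 0] with n hn
  rw [Real.rpow_sub_one (by positivity)]

theorem isSymbol_of_abs_iterate_fwdDiff_le {f : ℝ → ℝ} {γ : ℝ}
    (h : ∀ j : ℕ, ∃ C ≥ 0, ∀ x ≥ 1, |(Δ_[1])^[j] f x| ≤ C * x ^ (γ - j)) (j : ℕ) :
    IsSymbol j (fun n => (n : ℝ) ^ γ) (fun n => f n) := by
  have h0 : (fun n : ℕ => f n) =O[atTop] fun n : ℕ => (n : ℝ) ^ γ := by
    obtain ⟨C, hC, hb⟩ := h 0
    refine IsBigO.of_bound C ?_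
    filter_upwards [eventually_ge_atTop 1] with n hn
    have := hb n (by exact_mod_cast hn)
    rw [Real.norm_of_nonneg (r := (n : ℝ) ^ γ) (by positivity)]
    simpa using this
  induction j generalizing f γ with
  | zero => exact h0
  | succ j ih =>
    refine ⟨h0, ?_⟩
    have h1 : ∀ j : ℕ, ∃ C ≥ 0, ∀ x ≥ 1, |(Δ_[1])^[j] (Δ_[1] f) x| ≤ C * x ^ (γ - 1 - j) := by
      intro j
      obtain ⟨C, hC, hb⟩ := h (j + 1)
      refine ⟨C, hC, fun x hx => (hb x hx).trans_eq ?_⟩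
      congr 2
      push_cast
      ring
    have h2 : (fun n : ℕ => Δ_[1] f n) =O[atTop] fun n : ℕ => (n : ℝ) ^ (γ - 1) := by
      obtain ⟨C, hC, hb⟩ := h1 0
      refine IsBigO.of_bound C ?_
      filter_upwards [eventually_ge_atTop 1] with n hn
      have := hb n (by exact_mod_cast hn)
      rw [Real.norm_of_nonneg (r := (n : ℝ) ^ (γ - 1)) (by positivity)]
      simpa using this
    refine ((ih h1 h2).mono_weight (natCast_rpow_div γ).symm.isBigO).congr (.of_eq ?_)
    ext n
    simp [fwdDiff]

theorem isSymbol_natCast_rpow (j : ℕ) (γ : ℝ) :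
    IsSymbol j (fun n => (n : ℝ) ^ γ) (fun n => (n : ℝ) ^ γ) :=
  isSymbol_of_abs_iterate_fwdDiff_le (f := fun x => x ^ γ)
    (fun j => exists_abs_iterate_fwdDiff_rpow_le j γ) j

theorem hasOrder_natCast_rpow (j : ℕ) (γ : ℝ) : HasOrder j γ (fun n => (n : ℝ) ^ γ) :=
  fun ε hε => (isSymbol_natCast_rpow j γ).mono_weight (natCast_rpow_isBigO (by linarith))

theorem isSymbol_fwdDiff_log (j : ℕ) :
    IsSymbol j (fun n => (n : ℝ)⁻¹) (Δ_[1] fun n : ℕ => Real.log n) := by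
  refine ((isSymbol_of_abs_iterate_fwdDiff_le exists_abs_iterate_fwdDiff_log_le j).mono_weight
    (EventuallyEq.isBigO (.of_eq ?_))).congr (.of_eq ?_)
  · ext n
    exact Real.rpow_neg_one _
  · ext n
    simp [fwdDiff]

/-! ### Rational functions of `log n`, with the extra `1 / log n` in their differences. -/

theorem eventually_one_le_log_natCast : ∀ᶠ n : ℕ in atTop, 1 ≤ Real.log n :=
  (Real.tendsto_log_atTop.comp tendsto_natCast_atTop_atTop).eventually_ge_atTop 1

/-- `e` is a symbol of weight `v`, and its first difference gains an additional factor
`1 / log n`. -/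
structure IsLogSymbol (v e : ℕ → ℝ) : Prop where
  isSymbol : ∀ j, IsSymbol j v e
  isSymbol_fwdDiff : ∀ j, IsSymbol j (fun n => v n / (n * Real.log n)) (Δ_[1] e)

namespace IsLogSymbol

variable {v w e f : ℕ → ℝ}

theorem div_mul_log_isBigO (v : ℕ → ℝ) :
    (fun n : ℕ => v n / (n * Real.log n)) =O[atTop] v := by
  refine IsBigO.of_bound 1 ?_
  filter_upwards [eventually_ge_atTop 1, eventually_one_le_log_natCast] with n hn hl
  have : (1 : ℝ) ≤ n := by exact_mod_cast hn
  rw [norm_div, one_mul]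
  refine div_le_self (norm_nonneg _) ((one_le_mul_of_one_le_of_one_le this hl).trans
    (le_abs_self _))

theorem const (c : ℝ) : IsLogSymbol (fun _ => 1) (fun _ => c) where
  isSymbol _ := .const c
  isSymbol_fwdDiff j := by
    rw [show Δ_[1] (fun _ : ℕ => c) = fun _ => 0 by ext n; simp [fwdDiff]]
    exact .zero

theorem log : IsLogSymbol (fun n => Real.log n) (fun n => Real.log n) := by
  have h : (fun n : ℕ => (n : ℝ)⁻¹) =O[atTop] fun n : ℕ => Real.log n / n := by
    refine IsBigO.of_bound 1 ?_
    filter_upwards [eventually_one_le_log_natCast] with n hl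
    rw [div_eq_mul_inv, norm_mul, one_mul]
    exact le_mul_of_one_le_left (norm_nonneg _) (hl.trans (le_abs_self _))
  refine ⟨fun j => ?_, fun j => (isSymbol_fwdDiff_log j).mono_weight (EventuallyEq.isBigO ?_)⟩
  · cases j with
    | zero => exact isBigO_refl _ _
    | succ j => exact ⟨isBigO_refl _ _, (isSymbol_fwdDiff_log j).mono_weight h⟩
  · filter_upwards [eventually_one_le_log_natCast] with n hl
    have : Real.log n ≠ 0 := by linarith
    rw [div_mul_cancel_right₀ this]

theorem mono_weight (h : IsLogSymbol v e) (hvw : v =O[atTop] w) : IsLogSymbol w e where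
  isSymbol j := (h.isSymbol j).mono_weight hvw
  isSymbol_fwdDiff j := (h.isSymbol_fwdDiff j).mono_weight <| by
    simpa only [div_eq_mul_inv] using
      hvw.mul (isBigO_refl (fun n : ℕ => ((n : ℝ) * Real.log n)⁻¹) atTop)

theorem congr (he : IsLogSymbol v e) (hef : e =ᶠ[atTop] f) : IsLogSymbol v f where
  isSymbol j := (he.isSymbol j).congr hef
  isSymbol_fwdDiff j := (he.isSymbol_fwdDiff j).congr <| by
    filter_upwards [hef, (tendsto_add_atTop_nat 1).eventually hef] with n h0 h1
    simp only [fwdDiff, h0, h1]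

theorem add (he : IsLogSymbol v e) (hf : IsLogSymbol v f) :
    IsLogSymbol v (fun n => e n + f n) where
  isSymbol j := (he.isSymbol j).add (hf.isSymbol j)
  isSymbol_fwdDiff j := ((he.isSymbol_fwdDiff j).add (hf.isSymbol_fwdDiff j)).congr <| .of_eq <| by
    ext n
    simp only [fwdDiff]
    ring

theorem mul (he : IsLogSymbol v e) (hf : IsLogSymbol w f) :
    IsLogSymbol (fun n => v n * w n) (fun n => e n * f n) where
  isSymbol j := (he.isSymbol j).mul (hf.isSymbol j)
  isSymbol_fwdDiff j := by
    have h1 := (he.isSymbol_fwdDiff j).mul (hf.isSymbol j)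
    have h2 := (he.isSymbol j).mul (hf.isSymbol_fwdDiff j)
    have h3 := (he.isSymbol_fwdDiff j).mul
      ((hf.isSymbol_fwdDiff j).mono_weight (div_mul_log_isBigO w))
    have h2' : IsSymbol j (fun n => v n / (n * Real.log n) * w n) (fun n => e n * Δ_[1] f n) := by
      convert h2 using 2
      ring
    convert ((h1.add h2').add h3).congr (f := Δ_[1] fun n => e n * f n) (.of_eq ?_) using 2
    · ring
    · ext n
      simp only [fwdDiff]
      ring

theorem pow (he : IsLogSymbol v e) (i : ℕ) :
    IsLogSymbol (fun n => v n ^ i) (fun n => e n ^ i) := by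
  induction i with
  | zero => simpa using const 1
  | succ i ih => simpa only [pow_succ] using ih.mul he

theorem zero : IsLogSymbol v (fun _ => 0) where
  isSymbol _ := .zero
  isSymbol_fwdDiff j := by
    rw [show Δ_[1] (fun _ : ℕ => (0 : ℝ)) = fun _ => 0 by ext n; simp [fwdDiff]]
    exact .zero

theorem sum {ι : Type*} (s : Finset ι) {e : ι → ℕ → ℝ} (h : ∀ i ∈ s, IsLogSymbol v (e i)) :
    IsLogSymbol v (fun n => ∑ i ∈ s, e i n) := by
  classical
  induction s using Finset.induction_on with
  | empty => simpa using zero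
  | insert i s hi ih =>
    simp only [Finset.sum_insert hi]
    exact (h i (by simp)).add (ih fun k hk => h k (by simp [hk]))

end IsLogSymbol

/-- Reciprocals of symbols that are bounded below by their weight. -/
theorem IsSymbol.inv_of_isBigO {j : ℕ} {v e : ℕ → ℝ} (he : IsSymbol j v e)
    (hv : ∀ᶠ n in atTop, v n ≠ 0) (hve : v =O[atTop] e)
    (hs : (fun n => (v (n + 1))⁻¹) =O[atTop] fun n => (v n)⁻¹) :
    IsSymbol j (fun n => (v n)⁻¹) (fun n => (e n)⁻¹) := by
  have h0 : ∀ᶠ n in atTop, e n ≠ 0 := by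
    filter_upwards [hv, hve.eq_zero_imp] with n h1 h2 h3
    exact h1 (h2 h3)
  have hw : ∀ᶠ n in atTop, v n * (v n)⁻¹ = 1 := by
    filter_upwards [hv] with n h
    exact mul_inv_cancel₀ h
  refine (he.inv h0 (hve.inv_rev ?_) hs (hw.mono fun n h => h.ge)).mono_weight
    (EventuallyEq.isBigO ?_)
  · filter_upwards [hv] with n h1 h2
    exact absurd h2 h1
  · filter_upwards [hw] with n h
    rw [h, one_pow, mul_one]

theorem IsLogSymbol.inv {v e : ℕ → ℝ} (he : IsLogSymbol v e)
    (hv : ∀ᶠ n in atTop, v n ≠ 0) (hve : v =O[atTop] e)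
    (hs : (fun n => (v (n + 1))⁻¹) =O[atTop] fun n => (v n)⁻¹) :
    IsLogSymbol (fun n => (v n)⁻¹) (fun n => (e n)⁻¹) := by
  have hinv := fun j => (he.isSymbol j).inv_of_isBigO hv hve hs
  refine ⟨hinv, fun j => ?_⟩
  have h0 : ∀ᶠ n in atTop, e n ≠ 0 := by
    filter_upwards [hv, hve.eq_zero_imp] with n h1 h2 h3
    exact h1 (h2 h3)
  refine ((((he.isSymbol_fwdDiff j).neg.mul (hinv j)).mul (hinv (j + 1)).shift).mono_weight
    (EventuallyEq.isBigO ?_)).congr ?_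
  · filter_upwards [hv] with n h
    field_simp
  · filter_upwards [h0, (tendsto_add_atTop_nat 1).eventually h0] with n a b
    simp only [fwdDiff]
    field_simp
    ring

theorem tendsto_log_natCast_atTop : Tendsto (fun n : ℕ => Real.log n) atTop atTop :=
  Real.tendsto_log_atTop.comp tendsto_natCast_atTop_atTop

theorem log_zpow_isBigO_natCast_rpow (p : ℤ) {ε : ℝ} (hε : 0 < ε) :
    (fun n : ℕ => Real.log n ^ p) =O[atTop] fun n : ℕ => (n : ℝ) ^ ε := by
  have := (isLittleO_log_rpow_rpow_atTop (p : ℝ) hε).isBigO.comp_tendsto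
    (tendsto_natCast_atTop_atTop (R := ℝ))
  simpa only [Function.comp_def, Real.rpow_intCast] using this

theorem hasOrder_zero_of_isSymbol_log_zpow {j : ℕ} {p : ℤ} {e : ℕ → ℝ}
    (h : IsSymbol j (fun n => Real.log n ^ p) e) : HasOrder j 0 e := fun ε hε =>
  h.mono_weight (by simpa using log_zpow_isBigO_natCast_rpow p hε)

theorem isLogSymbol_eval_log (P : Polynomial ℝ) :
    IsLogSymbol (fun n => Real.log n ^ P.natDegree) (fun n => P.eval (Real.log n)) := by
  simp only [Polynomial.eval_eq_sum_range]
  refine .sum _ fun i hi => ?_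
  have h := (IsLogSymbol.const (P.coeff i)).mul (IsLogSymbol.log.pow i)
  refine h.mono_weight (IsBigO.of_bound 1 ?_)
  filter_upwards [eventually_one_le_log_natCast] with n hn
  rw [one_mul, one_mul, Real.norm_of_nonneg (by positivity), Real.norm_of_nonneg (by positivity)]
  exact pow_le_pow_right₀ hn (Nat.lt_succ_iff.mp (Finset.mem_range.mp hi))

/-- The denominator is comparable to its leading power of `log n`, so taking its reciprocal loses
nothing. -/
theorem isLogSymbol_eval_div_eval_log (P : Polynomial ℝ) {Q : Polynomial ℝ} (hQ : Q ≠ 0) :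
    IsLogSymbol (fun n => Real.log n ^ ((P.natDegree : ℤ) - Q.natDegree))
      (fun n => P.eval (Real.log n) / Q.eval (Real.log n)) := by
  have h1 : (fun n : ℕ => Real.log n ^ Q.natDegree) =O[atTop]
      fun n : ℕ => Q.eval (Real.log n) := by
    have h := (Q.isEquivalent_atTop_lead.isBigO_symm).comp_tendsto tendsto_log_natCast_atTop
    simp only [Function.comp_def] at h
    exact (isBigO_const_mul_left_iff (Polynomial.leadingCoeff_ne_zero.mpr hQ)).mp h
  have h2 := (isLogSymbol_eval_log Q).inv ?_ h1 ?_
  · refine ((isLogSymbol_eval_log P).mul h2).mono_weight (EventuallyEq.isBigO ?_)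
    filter_upwards [eventually_one_le_log_natCast] with n hn
    rw [zpow_sub₀ (by linarith), zpow_natCast, zpow_natCast, div_eq_mul_inv]
  · filter_upwards [eventually_one_le_log_natCast] with n hn
    positivity
  · refine IsBigO.of_bound 1 ?_
    filter_upwards [eventually_one_le_log_natCast, eventually_ge_atTop 1] with n hn hn1
    have h3 : Real.log n ≤ Real.log (n + 1 : ℕ) :=
      Real.log_le_log (by exact_mod_cast hn1) (by push_cast; linarith)
    rw [one_mul, norm_inv, norm_inv, Real.norm_of_nonneg (by positivity),
      Real.norm_of_nonneg (by positivity)]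
    gcongr

theorem log_zpow_isBigO_eval_div_eval {P Q : Polynomial ℝ} (hP : P ≠ 0) (hQ : Q ≠ 0) :
    (fun n : ℕ => Real.log n ^ ((P.natDegree : ℤ) - Q.natDegree)) =O[atTop]
      (fun n : ℕ => P.eval (Real.log n) / Q.eval (Real.log n)) := by
  have h := ((Polynomial.isEquivalent_atTop_div P Q).isBigO_symm).comp_tendsto
    tendsto_log_natCast_atTop
  simp only [Function.comp_def] at h
  exact (isBigO_const_mul_left_iff (div_ne_zero (Polynomial.leadingCoeff_ne_zero.mpr hP)
    (Polynomial.leadingCoeff_ne_zero.mpr hQ))).mp h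

theorem exists_log_zpow_le_mul_succ (p : ℤ) :
    ∃ K ≥ 1, ∀ᶠ n : ℕ in atTop, Real.log n ^ p ≤ K * Real.log (n + 1 : ℕ) ^ p := by
  refine ⟨2 ^ |p|, one_le_zpow₀ one_le_two (abs_nonneg p), ?_⟩
  filter_upwards [eventually_one_le_log_natCast, eventually_ge_atTop 2] with n hn hn1
  have hn2 : (2 : ℝ) ≤ n := by exact_mod_cast hn1
  have h1 : Real.log n ≤ Real.log (n + 1 : ℕ) :=
    Real.log_le_log (by linarith) (by push_cast; linarith)
  have h2 : Real.log (n + 1 : ℕ) ≤ 2 * Real.log n := by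
    rw [← Real.log_rpow (by linarith)]
    refine Real.log_le_log (by positivity) ?_
    push_cast
    norm_num
    nlinarith
  have h0 : 0 < Real.log (n + 1 : ℕ) := by linarith
  rcases le_total 0 p with hp | hp
  · have h3 : Real.log n ^ p ≤ Real.log (n + 1 : ℕ) ^ p := zpow_le_zpow_left₀ hp (by linarith) h1
    refine h3.trans (le_mul_of_one_le_left (by positivity) (one_le_zpow₀ one_le_two (abs_nonneg p)))
  · obtain ⟨d, rfl⟩ : ∃ d : ℕ, p = -d := ⟨p.natAbs, by omega⟩
    simp only [abs_neg, Nat.abs_cast, zpow_neg, zpow_natCast]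
    rw [← div_eq_mul_inv, le_div_iff₀ (by positivity), inv_mul_le_iff₀ (by positivity), mul_comm,
      ← mul_pow]
    gcongr

/-- The rational function `-r - c` in the variable `log n`. -/
theorem neg_ratVal_log_sub_isLogSymbol (r : RatFunc ℝ) (c : ℝ)
    (h : ∀ᶠ x : ℝ in atTop, ratVal r x < -c) :
    (∀ᶠ n : ℕ in atTop, 0 < -ratVal r (Real.log n) - c) ∧
      ∃ p : ℤ, IsLogSymbol (fun n => Real.log n ^ p) (fun n => -ratVal r (Real.log n) - c) ∧
        (fun n : ℕ => Real.log n ^ p) =O[atTop] fun n : ℕ => -ratVal r (Real.log n) - c := by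
  have hpos : ∀ᶠ n : ℕ in atTop, 0 < -ratVal r (Real.log n) - c := by
    filter_upwards [tendsto_log_natCast_atTop.eventually h] with n hn
    linarith
  have hden : ∀ᶠ n : ℕ in atTop, r.denom.eval (Real.log n) ≠ 0 :=
    tendsto_log_natCast_atTop.eventually
      (Polynomial.eventually_atTop_not_isRoot r.denom r.denom_ne_zero)
  set P : Polynomial ℝ := -r.num - Polynomial.C c * r.denom with hPdef
  have heq : (fun n : ℕ => P.eval (Real.log n) / r.denom.eval (Real.log n)) =ᶠ[atTop]
      fun n : ℕ => -ratVal r (Real.log n) - c := by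
    filter_upwards [hden] with n hn
    simp only [hPdef, ratVal, RatFunc.eval, Polynomial.eval₂_id, Polynomial.eval_sub,
      Polynomial.eval_neg, Polynomial.eval_mul, Polynomial.eval_C]
    field_simp
  -- The strict inequality is what makes the numerator nonzero, so that a definite power of `log n`
  -- bounds the function from below.
  have hP : P ≠ 0 := by
    intro h0
    obtain ⟨n, h1, h2⟩ := (hpos.and heq).exists
    simp only [h0, Polynomial.eval_zero, zero_div] at h2
    linarith
  exact ⟨hpos, _, (isLogSymbol_eval_div_eval_log P r.denom_ne_zero).congr heq,
    (log_zpow_isBigO_eval_div_eval hP r.denom_ne_zero).congr' EventuallyEq.rfl heq⟩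

theorem hasOrder_ratVal_log (r : RatFunc ℝ) (j : ℕ) :
    HasOrder j 0 (fun n => ratVal r (Real.log n)) :=
  hasOrder_zero_of_isSymbol_log_zpow
    ((isLogSymbol_eval_div_eval_log r.num r.denom_ne_zero).isSymbol j)

/-! ### The recursion on ratios and its estimates for symbols. -/

/-- The ratio `f n * f (n + 2) / f (n + 1) ^ 2` of three consecutive terms. -/
noncomputable def shiftRatio (f : ℕ → ℝ) (n : ℕ) : ℝ := f n * f (n + 2) / f (n + 1) ^ 2

/-- The effect of `logOp` on the sequence `1 - shiftRatio a`. -/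
noncomputable def ratioStep (f : ℕ → ℝ) (n : ℕ) : ℝ := 1 - (1 - f (n + 1)) ^ 2 * shiftRatio f n

/-- `f n * Δ²f n - (Δf n)²`, the numerator of `shiftRatio f - 1`. -/
def ratioNum (f : ℕ → ℝ) (n : ℕ) : ℝ := f n * Δ_[1] (Δ_[1] f) n - Δ_[1] f n * Δ_[1] f n

theorem shiftRatio_sub_one {f : ℕ → ℝ} {n : ℕ} (h : f (n + 1) ≠ 0) :
    shiftRatio f n - 1 = ratioNum f n * ((f (n + 1))⁻¹ * (f (n + 1))⁻¹) := by
  simp only [shiftRatio, ratioNum, fwdDiff]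
  field_simp
  ring

/-- An eventually positive symbol of order `ρ` whose reciprocal has order `-ρ`. -/
structure PosOrder (ρ : ℝ) (f : ℕ → ℝ) : Prop where
  hasOrder : ∀ j, HasOrder j ρ f
  pos : ∀ᶠ n in atTop, 0 < f n
  inv_zero : HasOrder 0 (-ρ) (fun n => (f n)⁻¹)

namespace PosOrder

variable {ρ σ δ : ℝ} {f g e : ℕ → ℝ}

theorem inv (h : PosOrder ρ f) (j : ℕ) : HasOrder j (-ρ) (fun n => (f n)⁻¹) :=
  (h.hasOrder j).inv (h.pos.mono fun _ hn => hn.ne') h.inv_zero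

theorem inv_succ (h : PosOrder ρ f) (j : ℕ) : HasOrder j (-ρ) (fun n => (f (n + 1))⁻¹) :=
  (h.inv (j + 1)).shift

theorem succ_pos (h : PosOrder ρ f) : ∀ᶠ n in atTop, 0 < f (n + 1) :=
  (tendsto_add_atTop_nat 1).eventually h.pos

theorem add (h : PosOrder ρ f) (he : ∀ j, HasOrder j σ e) (hσ : σ < ρ) :
    PosOrder ρ (fun n => f n + e n) := by
  obtain ⟨h1, h2⟩ := HasOrder.perturb h.pos h.inv_zero (he 0) hσ
  exact ⟨fun j => (h.hasOrder j).add ((he j).mono hσ.le), h1, h2⟩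

theorem mul (hf : PosOrder ρ f) (hg : PosOrder σ g) : PosOrder (ρ + σ) (fun n => f n * g n) where
  hasOrder j := (hf.hasOrder j).mul (hg.hasOrder j)
  pos := by
    filter_upwards [hf.pos, hg.pos] with n h1 h2
    exact mul_pos h1 h2
  inv_zero := by
    simp only [mul_inv]
    exact hf.inv_zero.mul_le hg.inv_zero (by linarith)

theorem const_mul {c : ℝ} (hc : 0 < c) (hf : PosOrder ρ f) : PosOrder ρ (fun n => c * f n) where
  hasOrder j := (hf.hasOrder j).const_mul c
  pos := hf.pos.mono fun n hn => mul_pos hc hn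
  inv_zero := by
    simp only [mul_inv]
    exact hf.inv_zero.const_mul c⁻¹

theorem ratioNum_hasOrder (hf : PosOrder ρ f) (j : ℕ) : HasOrder j (2 * ρ - 2) (ratioNum f) :=
  ((hf.hasOrder j).mul_le (hf.hasOrder (j + 2)).fwdDiff.fwdDiff (by linarith)).sub
    ((hf.hasOrder (j + 1)).fwdDiff.mul_le (hf.hasOrder (j + 1)).fwdDiff (by linarith))

/-- Both products in `ratioNum` contain two differences, hence the gain `n ^ (-2)` over the square
in the denominator. -/
theorem shiftRatio_sub_one_hasOrder (hf : PosOrder ρ f) (j : ℕ) :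
    HasOrder j (-2) (fun n => shiftRatio f n - 1) := by
  refine ((hf.ratioNum_hasOrder j).mul_le ((hf.inv_succ j).mul (hf.inv_succ j))
    (by linarith)).congr ?_
  filter_upwards [hf.succ_pos] with n hn
  rw [shiftRatio_sub_one hn.ne']

/-- `ratioStep f = 2 f - (shiftRatio f - 1)` up to lower order terms. -/
theorem ratioStep_hasOrder (hf : PosOrder ρ f) (h1 : ρ - 1 ≤ σ) (h2 : 2 * ρ ≤ σ)
    (j : ℕ) : HasOrder j σ (fun n => ratioStep f n - 2 * f n + (shiftRatio f n - 1)) := by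
  have hs := (hf.hasOrder (j + 1)).shift
  have hR := hf.shiftRatio_sub_one_hasOrder j
  have a1 := ((hf.hasOrder (j + 1)).fwdDiff.mono h1).const_mul 2
  have a2 := hs.mul_le hs (τ := σ) (by linarith)
  have a3 := (hs.mul_le hR (τ := σ) (by linarith)).const_mul 2
  have a4 := hs.mul_le (hs.mul hR) (τ := σ) (by linarith)
  refine (((a1.sub a2).add a3).sub a4).congr (.of_eq ?_)
  ext n
  simp only [ratioStep, fwdDiff]
  ring

/-- A relative perturbation of order `-δ` keeps that gain on top of the two differences: `b1` is the
change of the numerator and `b2` that of the denominator. -/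
theorem shiftRatio_add_sub_hasOrder (hf : PosOrder ρ f) (he : ∀ j, HasOrder j (ρ - δ) e)
    (hδ : 0 < δ) (j : ℕ) :
    HasOrder j (-2 - δ) (fun n => shiftRatio (fun n => f n + e n) n - shiftRatio f n) := by
  have hg := hf.add he (by linarith)
  have f0 := hf.hasOrder j
  have f1 := (hf.hasOrder (j + 1)).fwdDiff
  have f2 := (hf.hasOrder (j + 2)).fwdDiff.fwdDiff
  have e0 := he j
  have e1 := (he (j + 1)).fwdDiff
  have e2 := (he (j + 2)).fwdDiff.fwdDiff
  have gi := (hg.inv_succ j).mul (hg.inv_succ j)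
  have fi := (hf.inv_succ j).mul (hf.inv_succ j)
  have a1 := f0.mul_le e2 (τ := 2 * ρ - 2 - δ) (by linarith)
  have a2 := e0.mul_le f2 (τ := 2 * ρ - 2 - δ) (by linarith)
  have a3 := e0.mul_le e2 (τ := 2 * ρ - 2 - δ) (by linarith)
  have a4 := (f1.mul_le e1 (τ := 2 * ρ - 2 - δ) (by linarith)).const_mul 2
  have a5 := e1.mul_le e1 (τ := 2 * ρ - 2 - δ) (by linarith)
  have b1 := ((((a1.add a2).add a3).sub a4).sub a5).mul_le gi (τ := -2 - δ) (by linarith)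
  have fs := (hf.hasOrder (j + 1)).shift
  have es := (he (j + 1)).shift
  have c1 := (es.mul_le ((fs.const_mul 2).add (es.mono (by linarith)))
    (τ := 2 * ρ - δ) (by linarith))
  have b2 := (hf.ratioNum_hasOrder j).mul_le (c1.mul (gi.mul fi)) (τ := -2 - δ) (by linarith)
  refine (b1.sub b2).congr ?_
  filter_upwards [hf.succ_pos, hg.succ_pos] with n h1 h2
  have h1' := h1.ne'
  have h2' := h2.ne'
  simp only [shiftRatio, ratioNum, fwdDiff]
  field_simp
  ring

end PosOrder

/-! ### Errors without difference bounds, and the reduction to iterates of `ratioStep`. -/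

/-- Stability of `ratioStep` under perturbations of order `-B`; the step loses a factor `n ^ α`. -/
theorem ratioStep_sub_hasOrder {α B : ℝ} {f F : ℕ → ℝ} (hF : PosOrder (-α) F) (hα : 0 ≤ α)
    (he : HasOrder 0 (-B) (fun n => f n - F n)) (hB : α < B) :
    HasOrder 0 (-(B - α)) (fun n => ratioStep f n - ratioStep F n) := by
  obtain ⟨hpos, hi⟩ := HasOrder.perturb hF.pos hF.inv_zero he (by linarith)
  simp only [add_sub_cancel] at hpos hi
  have F0 := hF.hasOrder 0
  have F1 := F0.shift_zero
  have F2 := F1.shift_zero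
  have e1 := he.shift_zero
  have e2 := e1.shift_zero
  have f1 : HasOrder 0 (-α) (fun n => f (n + 1)) :=
    (F1.add (e1.mono (by linarith))).congr (.of_eq (by ext n; ring))
  have fi := hi.shift_zero.mul hi.shift_zero
  have Fi := (hF.inv_succ 0).mul (hF.inv_succ 0)
  have a1 := (F0.mul_le e2 (τ := -α - B) (by linarith)).mul_le (F1.mul F1)
    (τ := -3 * α - B) (by linarith)
  have a2 := (he.mul_le F2 (τ := -α - B) (by linarith)).mul_le (F1.mul F1)
    (τ := -3 * α - B) (by linarith)
  have a3 := (he.mul_le e2 (τ := -α - B) (by linarith)).mul_le (F1.mul F1)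
    (τ := -3 * α - B) (by linarith)
  have a4 := ((F0.mul F2).mul_le (F1.mul e1) (τ := -3 * α - B) (by linarith)).const_mul 2
  have a5 := (F0.mul F2).mul_le (e1.mul e1) (τ := -3 * α - B) (by linarith)
  have hR := ((((a1.add a2).add a3).sub a4).sub a5).mul_le (fi.mul Fi) (τ := -(B - α))
    (by linarith)
  have c1 : HasOrder 0 0 (fun n => 1 - f (n + 1)) :=
    (HasOrder.const 1).sub (f1.mono (by linarith))
  have c2 : HasOrder 0 0 (fun n => 1 - F (n + 1)) :=
    (HasOrder.const 1).sub (F1.mono (by linarith))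
  have b1 := (c1.mul c1).mul_le hR (τ := -(B - α)) (by linarith)
  have b2 := (e1.mul (c1.add c2)).mul_le ((F0.mul F2).mul Fi) (τ := -(B - α)) (by linarith)
  refine (b2.sub b1).congr ?_
  filter_upwards [hF.succ_pos, (tendsto_add_atTop_nat 1).eventually hpos] with n h1 h2
  have h1' := h1.ne'
  have h2' := h2.ne'
  simp only [ratioStep, shiftRatio]
  field_simp
  ring

theorem logOp_eq {b : ℕ → ℝ} {n : ℕ} (h : b (n + 1) ≠ 0) :
    logOp b n = b (n + 1) ^ 2 * (1 - shiftRatio b n) := by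
  simp only [logOp, shiftRatio]
  field_simp

/-- By `logOp_eq` the ratio for `logOp b` is a product: the factors `b (n + 1) ^ 2` contribute
`shiftRatio b (n + 1) ^ 2`, the others `shiftRatio (1 - shiftRatio b)`. -/
theorem one_sub_shiftRatio_logOp {b : ℕ → ℝ} {n : ℕ} (h1 : b (n + 1) ≠ 0) (h2 : b (n + 2) ≠ 0)
    (h3 : b (n + 3) ≠ 0) :
    1 - shiftRatio (logOp b) n = ratioStep (fun n => 1 - shiftRatio b n) n := by
  have e : shiftRatio (logOp b) n = logOp b n * logOp b (n + 2) / logOp b (n + 1) ^ 2 := rfl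
  have hr : shiftRatio b (n + 1) = b (n + 1) * b (n + 3) / b (n + 2) ^ 2 := rfl
  rw [e, logOp_eq h1, logOp_eq (n := n + 1) h2, logOp_eq (n := n + 2) h3]
  simp only [ratioStep, sub_sub_cancel]
  have e' : shiftRatio (fun n => 1 - shiftRatio b n) n = (1 - shiftRatio b n) *
    (1 - shiftRatio b (n + 2)) / (1 - shiftRatio b (n + 1)) ^ 2 := rfl
  rw [e', mul_pow]
  congr 1
  rw [show shiftRatio b (n + 1) ^ 2 = (b (n + 1) * b (n + 3) / b (n + 2) ^ 2) ^ 2 by rw [hr],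
    div_pow, div_mul_div_comm]
  congr 1
  ring

theorem logOp_iterate_add (a : ℕ → ℝ) (N k n : ℕ) :
    (logOp^[k] fun n => a (N + n)) n = (logOp^[k] a) (N + n) := by
  induction k generalizing a with
  | zero => rfl
  | succ k ih => exact ih (logOp a)

/-- If `1 - a n * a (n + 2) / a (n + 1) ^ 2` is approximated by a sequence `F` whose iterates under
`ratioStep` are positive symbols, then `a` is asymptotically `ℓ`-log-concave. -/
theorem isAsympLogConcaveSeq_of_posOrder {a F : ℕ → ℝ} {α B : ℝ} {ℓ : ℕ} (hα : 0 < α)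
    (hB : ℓ * α < B) (ha : ∀ᶠ n in atTop, a n ≠ 0)
    (hF : ∀ k < ℓ, PosOrder (-α) (ratioStep^[k] F))
    (he : HasOrder 0 (-B) (fun n => 1 - shiftRatio a n - F n)) : IsAsympLogConcaveSeq ℓ a := by
  have step : ∀ k < ℓ, (∀ᶠ n in atTop, (logOp^[k] a) n ≠ 0) →
      HasOrder 0 (-(B - k * α)) (fun n => 1 - shiftRatio (logOp^[k] a) n - (ratioStep^[k] F) n) →
      ∀ᶠ n in atTop, 0 < (logOp^[k + 1] a) n := by
    intro k hk h0 hk'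
    have hk1 : ((k : ℝ) + 1) * α ≤ ℓ * α := by
      gcongr
      exact_mod_cast hk
    have hpos := (HasOrder.perturb (hF k hk).pos (hF k hk).inv_zero hk' (by linarith)).1
    filter_upwards [hpos, (tendsto_add_atTop_nat 1).eventually h0] with n h1 h2
    rw [add_sub_cancel] at h1
    rw [Function.iterate_succ_apply', logOp_eq h2]
    positivity
  -- Positivity from `step` also supplies the nonvanishing needed to form the next ratio.
  have main : ∀ k ≤ ℓ, (∀ᶠ n in atTop, (logOp^[k] a) n ≠ 0) ∧ HasOrder 0 (-(B - k * α))
      (fun n => 1 - shiftRatio (logOp^[k] a) n - (ratioStep^[k] F) n) := by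
    intro k
    induction k with
    | zero => exact fun _ => ⟨ha, by simpa using he⟩
    | succ k ih =>
      intro hk
      obtain ⟨h0, h1⟩ := ih (by omega)
      refine ⟨(step k hk h0 h1).mono fun n hn => hn.ne', ?_⟩
      have hk1 : ((k : ℝ) + 1) * α ≤ ℓ * α := by
        gcongr
        exact_mod_cast hk
      refine ((ratioStep_sub_hasOrder (hF k hk) hα.le h1 (by linarith)).mono ?_).congr ?_
      · push_cast
        linarith
      · filter_upwards [(tendsto_add_atTop_nat 1).eventually h0,
          (tendsto_add_atTop_nat 2).eventually h0, (tendsto_add_atTop_nat 3).eventually h0]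
          with n a1 a2 a3
        rw [Function.iterate_succ_apply', Function.iterate_succ_apply',
          one_sub_shiftRatio_logOp a1 a2 a3]
  have hall : ∀ᶠ n in atTop, ∀ k ∈ Finset.range ℓ, 0 < (logOp^[k + 1] a) n := by
    rw [eventually_all_finset]
    intro k hk
    have hk' := Finset.mem_range.mp hk
    exact step k hk' (main k hk'.le).1 (main k hk'.le).2
  obtain ⟨N, hN⟩ := eventually_atTop.mp hall
  refine ⟨N, fun k hk1 hk n => ?_⟩
  obtain ⟨k, rfl⟩ := Nat.exists_eq_add_of_le' hk1
  rw [logOp_iterate_add]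
  exact (hN (N + n) (by omega) k (Finset.mem_range.mpr (by omega))).le

/-! ### The case of leading exponent below 2. -/

/-- Iterates of `ratioStep` on symbols of order `-α` with `0 < α < 2`. -/
theorem posOrder_iterate_ratioStep {α δ : ℝ} {M E : ℕ → ℝ} (hM : PosOrder (-α) M)
    (hE : ∀ j, HasOrder j (-α - δ) E) (hδ : 0 < δ) (h1 : δ ≤ 1) (hα : δ ≤ α) (h2 : δ ≤ 2 - α)
    (k : ℕ) : PosOrder (-α) (ratioStep^[k] fun n => M n + E n) := by
  have main : ∃ E' : ℕ → ℝ, (∀ j, HasOrder j (-α - δ) E') ∧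
      (ratioStep^[k] fun n => M n + E n) = fun n => 2 ^ k * M n + E' n := by
    induction k with
    | zero => exact ⟨E, hE, by simp⟩
    | succ k ih =>
      obtain ⟨E', hE', heq⟩ := ih
      have hF : PosOrder (-α) fun n => 2 ^ k * M n + E' n :=
        (hM.const_mul (by positivity)).add hE' (by linarith)
      rw [Function.iterate_succ_apply', heq]
      refine ⟨fun n => ratioStep (fun n => 2 ^ k * M n + E' n) n - 2 ^ (k + 1) * M n,
        fun j => ?_, by ext n; ring⟩
      -- The errors have orders `-α - 1` (index shift), `-2 α` (quadratic terms) and `-2`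
      -- (`shiftRatio - 1`); the three bounds on `δ` absorb them.
      refine (((hF.ratioStep_hasOrder (σ := -α - δ) (by linarith) (by linarith) j).sub
        ((hF.shiftRatio_sub_one_hasOrder j).mono (by linarith))).add
        ((hE' j).const_mul 2)).congr (.of_eq ?_)
      ext n
      ring
  obtain ⟨E', hE', heq⟩ := main
  rw [heq]
  exact (hM.const_mul (by positivity)).add hE' (by linarith)

/-! ### The case of leading exponent 2, with corrections measured by `logWeight`. -/

/-- The weight `v / ((1 + v) log n)` for `v = (log n) ^ p`. -/
noncomputable def logWeight (p : ℤ) (n : ℕ) : ℝ :=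
  Real.log n ^ p / ((1 + Real.log n ^ p) * Real.log n)

theorem logWeight_le (p : ℤ) {n : ℕ} (hn : 1 ≤ Real.log n) :
    0 ≤ logWeight p n ∧ logWeight p n ≤ 1 ∧ logWeight p n ≤ Real.log n ^ p / Real.log n := by
  have hv : 0 < Real.log n ^ p := by positivity
  refine ⟨by unfold logWeight; positivity, ?_, ?_⟩
  · rw [logWeight, div_le_one (by positivity)]
    nlinarith
  · refine div_le_div_of_nonneg_left hv.le (by positivity) ?_
    nlinarith

section

variable {p : ℤ} {τ σ : ℕ → ℝ} {A b : ℝ}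

/-- `σ` is `O(v / log n)` and `v = O(τ)`, so `σ` is eventually at most half of `A * τ`, even when
`τ` tends to zero. -/
theorem half_le_add_add (hv : (fun n : ℕ => Real.log n ^ p) =O[atTop] τ)
    (hpos : ∀ᶠ n in atTop, 0 < τ n) (hσ : σ =O[atTop] logWeight p) (hA : 0 < A) :
    ∀ᶠ n in atTop, A * τ n / 2 + b ≤ A * τ n + b + σ n := by
  obtain ⟨K, hK, hvK⟩ := hv.exists_pos
  obtain ⟨C, hC, hσC⟩ := hσ.exists_pos
  filter_upwards [hvK.bound, hσC.bound, hpos, eventually_one_le_log_natCast,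
    tendsto_log_natCast_atTop.eventually_ge_atTop (2 * C * K / A)] with n h1 h2 h3 h4 h5
  obtain ⟨w0, -, w2⟩ := logWeight_le p h4
  have hv0 : 0 < Real.log n ^ p := by positivity
  rw [Real.norm_of_nonneg hv0.le, Real.norm_of_nonneg h3.le] at h1
  rw [Real.norm_of_nonneg w0] at h2
  have h6 : |σ n| ≤ A * τ n / 2 := by
    calc |σ n| ≤ C * logWeight p n := h2
      _ ≤ C * (Real.log n ^ p / Real.log n) := by gcongr
      _ ≤ C * (K * τ n / (2 * C * K / A)) := by gcongr
      _ = A * τ n / 2 := by field_simp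
  linarith [neg_abs_le (σ n)]

theorem posOrder_zero_add_add (hτ : IsLogSymbol (fun n => Real.log n ^ p) τ)
    (hv : (fun n : ℕ => Real.log n ^ p) =O[atTop] τ) (hpos : ∀ᶠ n in atTop, 0 < τ n)
    (hσ : ∀ j, IsSymbol j (logWeight p) σ) (hA : 0 < A) (hb : 0 ≤ b) :
    PosOrder 0 (fun n => A * τ n + b + σ n) where
  hasOrder j := by
    refine (((hasOrder_zero_of_isSymbol_log_zpow (hτ.isSymbol j)).const_mul A).add
      (.const b)).add (hasOrder_zero_of_isSymbol_log_zpow (p := 0) ((hσ j).mono_weight ?_))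
    refine IsBigO.of_bound 1 ?_
    filter_upwards [eventually_one_le_log_natCast] with n hn
    obtain ⟨w0, w1, -⟩ := logWeight_le p hn
    simpa [abs_of_nonneg w0] using w1
  pos := by
    filter_upwards [half_le_add_add (b := b) hv hpos (hσ 0) hA, hpos] with n h1 h2
    nlinarith
  inv_zero := by
    intro ε hε
    have h1 : (fun n : ℕ => Real.log n ^ p) =O[atTop] fun n => A * τ n + b + σ n := by
      refine hv.trans (IsBigO.of_bound (2 / A) ?_)
      filter_upwards [half_le_add_add (b := b) hv hpos (hσ 0) hA, hpos] with n h1 h2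
      have h3 : 0 < A * τ n := by positivity
      rw [Real.norm_of_nonneg h2.le, Real.norm_of_nonneg (by linarith), div_mul_eq_mul_div,
        le_div_iff₀ hA]
      linarith
    have h2 := h1.inv_rev (by
      filter_upwards [eventually_one_le_log_natCast] with n hn h0
      exact absurd h0 (by positivity))
    refine IsBigO.trans h2 ?_
    simpa using log_zpow_isBigO_natCast_rpow (-p) hε

/-- Since `b > 0`, the sum `t` is comparable to `1 + v`, whereas `Δt` only has weight `v / (n log
n)`. The dominant term `Δ²t / t` therefore has weight `logWeight p n / n ^ 2`, and `(Δt / t) ^ 2` is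
smaller. -/
theorem isSymbol_shiftRatio_add_add_sub_one (hτ : IsLogSymbol (fun n => Real.log n ^ p) τ)
    (hv : (fun n : ℕ => Real.log n ^ p) =O[atTop] τ) (hpos : ∀ᶠ n in atTop, 0 < τ n)
    (hσ : ∀ j, IsSymbol j (logWeight p) σ) (hA : 0 < A) (hb : 0 < b) (j : ℕ) :
    IsSymbol j (fun n => logWeight p n / (n : ℝ) ^ 2)
      (fun n => shiftRatio (fun n => A * τ n + b + σ n) n - 1) := by
  set t : ℕ → ℝ := fun n => A * τ n + b + σ n with ht
  set V : ℕ → ℝ := fun n => 1 + Real.log n ^ p with hV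
  have htV : ∀ j, IsSymbol j V t := by
    intro j
    refine (((hτ.isSymbol j).const_mul A).mono_weight ?_ |>.add
      ((IsSymbol.const b).mono_weight ?_)).add ((hσ j).mono_weight ?_)
    all_goals
      refine IsBigO.of_bound 1 ?_
      filter_upwards [eventually_one_le_log_natCast] with n hn
      obtain ⟨w0, w1, -⟩ := logWeight_le p hn
      have hv0 : 0 < Real.log n ^ p := by positivity
      rw [one_mul, Real.norm_of_nonneg (by linarith),
        Real.norm_of_nonneg (by simp only [hV]; linarith)]
      simp only [hV]
      linarith
  have hd : ∀ j, IsSymbol j (fun n => Real.log n ^ p / (n * Real.log n)) (Δ_[1] t) := by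
    intro j
    refine (((hτ.isSymbol_fwdDiff j).const_mul A).add
      ((hσ (j + 1)).fwdDiff.mono_weight ?_)).congr (.of_eq ?_)
    · refine IsBigO.of_bound 1 ?_
      filter_upwards [eventually_one_le_log_natCast] with n hn
      obtain ⟨w0, -, w2⟩ := logWeight_le p hn
      rw [one_mul, Real.norm_of_nonneg (by positivity), Real.norm_of_nonneg (by positivity),
        mul_comm (n : ℝ), ← div_div]
      gcongr
    · ext n
      simp only [ht, fwdDiff]
      ring
  have hVt : V =O[atTop] t := by
    obtain ⟨K, hK, hvK⟩ := hv.exists_pos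
    refine IsBigO.of_bound (1 / b + 2 * K / A) ?_
    filter_upwards [half_le_add_add (b := b) hv hpos (hσ 0) hA, hpos, hvK.bound,
      eventually_one_le_log_natCast] with n h1 h2 h3 hn
    have hv0 : 0 < Real.log n ^ p := by positivity
    have h4 : 0 < A * τ n := by positivity
    rw [Real.norm_of_nonneg hv0.le, Real.norm_of_nonneg h2.le] at h3
    have ht0 : 0 ≤ t n := by simp only [ht]; linarith
    rw [Real.norm_of_nonneg (by simp only [hV]; linarith), Real.norm_of_nonneg ht0, add_mul]
    have h5 : 1 ≤ 1 / b * t n := by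
      rw [div_mul_eq_mul_div, le_div_iff₀ hb]
      simp only [ht]
      linarith
    have h6 : K * τ n ≤ 2 * K / A * t n := by
      rw [div_mul_eq_mul_div, le_div_iff₀ hA]
      have : A * τ n / 2 ≤ t n := by simp only [ht]; linarith
      nlinarith
    simp only [hV]
    linarith
  have hV0 : ∀ᶠ n in atTop, V n ≠ 0 := by
    filter_upwards [eventually_one_le_log_natCast] with n hn
    positivity
  have hVs : (fun n => (V (n + 1))⁻¹) =O[atTop] fun n => (V n)⁻¹ := by
    obtain ⟨K, hK, h⟩ := exists_log_zpow_le_mul_succ p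
    refine IsBigO.of_bound K ?_
    filter_upwards [h, eventually_one_le_log_natCast,
      (tendsto_add_atTop_nat 1).eventually eventually_one_le_log_natCast] with n h1 h2 h3
    have hv0 : 0 < Real.log n ^ p := by positivity
    have hv1 : 0 < Real.log (n + 1 : ℕ) ^ p := zpow_pos (by linarith) _
    simp only [hV]
    rw [norm_inv, norm_inv, Real.norm_of_nonneg (by linarith), Real.norm_of_nonneg (by linarith),
      ← div_eq_mul_inv, le_div_iff₀ (by linarith), inv_mul_le_iff₀ (by linarith)]
    nlinarith
  have hi := ((htV (j + 1)).inv_of_isBigO hV0 hVt hVs).shift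
  have a1 := ((htV j).mul (hd (j + 1)).fwdDiff).mul (hi.mul hi)
  have a2 := ((hd j).mul (hd j)).mul (hi.mul hi)
  refine ((a1.mono_weight (EventuallyEq.isBigO ?_)).sub (a2.mono_weight ?_)).congr ?_
  · filter_upwards [hV0, eventually_one_le_log_natCast] with n h1 h2
    simp only [logWeight, hV] at h1 ⊢
    have : Real.log n ≠ 0 := by linarith
    field_simp
  · refine IsBigO.of_bound 1 ?_
    filter_upwards [hV0, eventually_one_le_log_natCast] with n h1 h2
    obtain ⟨w0, w1, -⟩ := logWeight_le p h2
    have e : Real.log n ^ p / (n * Real.log n) * (Real.log n ^ p / (n * Real.log n)) *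
        ((V n)⁻¹ * (V n)⁻¹) = logWeight p n * logWeight p n / (n : ℝ) ^ 2 := by
      have : Real.log n ≠ 0 := by linarith
      simp only [logWeight, hV] at h1 ⊢
      field_simp
    rw [e, one_mul, Real.norm_of_nonneg (by positivity), Real.norm_of_nonneg (by positivity)]
    gcongr
    exact mul_le_of_le_one_left w0 w1
  · have h0 := (posOrder_zero_add_add hτ hv hpos hσ hA hb.le).succ_pos
    filter_upwards [h0] with n hn
    rw [shiftRatio_sub_one hn.ne', ratioNum]
    ring

end

theorem posOrder_natCast_rpow (γ : ℝ) : PosOrder γ (fun n => (n : ℝ) ^ γ) where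
  hasOrder j := hasOrder_natCast_rpow j γ
  pos := by
    filter_upwards [eventually_gt_atTop 0] with n hn
    positivity
  inv_zero := (hasOrder_natCast_rpow 0 (-γ)).congr <| .of_eq <| by
    ext n
    exact Real.rpow_neg (by positivity) _

/-- The ratio equals `(1 + 1 / (n (n + 2))) ^ 2`, and `2 / (n (n + 2)) - 2 / n ^ 2 = -4 / (n ^ 2 (n
+ 2))`. -/
theorem shiftRatio_rpow_neg_two_hasOrder (j : ℕ) :
    HasOrder j (-3) (fun n =>
      shiftRatio (fun n => (n : ℝ) ^ (-2 : ℝ)) n - 1 - 2 * (n : ℝ) ^ (-2 : ℝ)) := by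
  have h2 := hasOrder_natCast_rpow j (-2)
  have h1 := (hasOrder_natCast_rpow (j + 2) (-1)).shift.shift
  refine (((h2.mul_le h1 (τ := -3) (by norm_num)).const_mul (-4)).add
    (h2.mul_le (h1.mul h1) (τ := -3) (by norm_num))).congr ?_
  filter_upwards [eventually_gt_atTop 0] with n hn
  have e : ∀ m : ℕ, (m : ℝ) ^ (-2 : ℝ) = ((m : ℝ) ^ 2)⁻¹ := fun m => by
    rw [Real.rpow_neg (by positivity), Real.rpow_two]
  have hn' : (n : ℝ) ≠ 0 := by positivity
  simp only [shiftRatio, e, Real.rpow_neg_one]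
  push_cast
  field_simp
  ring

theorem shiftRatio_mul (f g : ℕ → ℝ) (n : ℕ) :
    shiftRatio (fun n => f n * g n) n = shiftRatio f n * shiftRatio g n := by
  simp only [shiftRatio, div_mul_div_comm]
  congr 1 <;> ring

/-- Iterates of `ratioStep` on symbols of order `-2`. -/
theorem posOrder_iterate_ratioStep_two {p : ℤ} {τ E : ℕ → ℝ} {γ δ : ℝ} {ℓ : ℕ}
    (hτ : IsLogSymbol (fun n => Real.log n ^ p) τ)
    (hv : (fun n : ℕ => Real.log n ^ p) =O[atTop] τ) (hpos : ∀ᶠ n in atTop, 0 < τ n)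
    (hE : ∀ j, HasOrder j (-2 - δ) E) (hδ : 0 < δ) (hδ1 : δ ≤ 1) (hγ : 0 < γ)
    (hℓ : ∀ k < ℓ, 2 ^ k * γ ≤ 2) {k : ℕ} (hk : k < ℓ) :
    PosOrder (-2) (ratioStep^[k] fun n => (n : ℝ) ^ (-2 : ℝ) * (τ n + (2 - γ)) + E n) := by
  have hM : ∀ k < ℓ, ∀ σ : ℕ → ℝ, (∀ j, IsSymbol j (logWeight p) σ) →
      PosOrder (-2) fun n => (n : ℝ) ^ (-2 : ℝ) * (2 ^ k * τ n + (2 - 2 ^ k * γ) + σ n) := by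
    intro k hk σ hσ
    simpa using (posOrder_natCast_rpow (-2)).mul (posOrder_zero_add_add hτ hv hpos hσ
      (by positivity : (0 : ℝ) < 2 ^ k) (sub_nonneg.mpr (hℓ k hk)))
  have main : ∀ k < ℓ, ∃ σ E' : ℕ → ℝ, (∀ j, IsSymbol j (logWeight p) σ) ∧
      (∀ j, HasOrder j (-2 - δ) E') ∧
      (ratioStep^[k] fun n => (n : ℝ) ^ (-2 : ℝ) * (τ n + (2 - γ)) + E n) = fun n : ℕ =>
        (n : ℝ) ^ (-2 : ℝ) * (2 ^ k * τ n + (2 - 2 ^ k * γ) + σ n) + E' n := by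
    intro k
    induction k with
    | zero => exact fun _ => ⟨fun _ => 0, E, fun j => .zero, hE, by simp⟩
    | succ k ih =>
      intro hk
      obtain ⟨σ, E', hσ, hE', heq⟩ := ih (by omega)
      -- Strict because a further step remains, `k + 1 < ℓ`; at the last index only nonnegativity is
      -- available, and only positivity of the iterate is needed.
      have hb : 0 < 2 - 2 ^ k * γ := by
        have h1 := hℓ (k + 1) hk
        have h2 : 0 < 2 ^ k * γ := by positivity
        rw [pow_succ] at h1
        linarith
      rw [Function.iterate_succ_apply', heq]
      set t : ℕ → ℝ := fun n => 2 ^ k * τ n + (2 - 2 ^ k * γ) + σ n with ht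
      have hMk : PosOrder (-2) fun n => (n : ℝ) ^ (-2 : ℝ) * t n := hM k (by omega) σ hσ
      have hFk := hMk.add hE' (by linarith)
      have htp : PosOrder 0 t := posOrder_zero_add_add hτ hv hpos hσ (by positivity) hb.le
      have hRt := isSymbol_shiftRatio_add_add_sub_one hτ hv hpos hσ
        (by positivity : (0 : ℝ) < 2 ^ k) hb
      have hσ' : ∀ j, IsSymbol j (logWeight p)
          (fun n => (n : ℝ) ^ (2 : ℝ) * (shiftRatio t n - 1)) := by
        intro j
        refine ((isSymbol_natCast_rpow j 2).mul (hRt j)).mono_weight (EventuallyEq.isBigO ?_)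
        filter_upwards [eventually_gt_atTop 0] with n hn
        rw [Real.rpow_two]
        field_simp
      -- `shiftRatio` is multiplicative: the factor `n ^ (-2)` contributes `2 / n ^ 2`, turning the
      -- constant into `2 (2 - 2 ^ k γ) - 2 = 2 - 2 ^ (k + 1) γ`, and `t` contributes the correction
      -- put into `σ`.
      refine ⟨fun n => 2 * σ n - (n : ℝ) ^ (2 : ℝ) * (shiftRatio t n - 1),
        fun n => ratioStep (fun n => (n : ℝ) ^ (-2 : ℝ) * t n + E' n) n -
          (n : ℝ) ^ (-2 : ℝ) * (2 ^ (k + 1) * τ n + (2 - 2 ^ (k + 1) * γ) +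
            (2 * σ n - (n : ℝ) ^ (2 : ℝ) * (shiftRatio t n - 1))),
        fun j => ((hσ j).const_mul 2).sub (hσ' j), fun j => ?_, by ext n; ring⟩
      have x1 := hFk.ratioStep_hasOrder (σ := -2 - δ) (by linarith) (by linarith) j
      have x2 := hMk.shiftRatio_add_sub_hasOrder hE' hδ j
      have x3 := (hE' j).const_mul 2
      have x4 := (shiftRatio_rpow_neg_two_hasOrder j).mono (σ := -2 - δ) (by linarith)
      have x5 := ((posOrder_natCast_rpow (-2)).shiftRatio_sub_one_hasOrder j).mul_le
        (htp.shiftRatio_sub_one_hasOrder j) (τ := -2 - δ) (by linarith)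
      refine ((((x1.sub x2).add x3).sub x4).sub x5).congr ?_
      filter_upwards [eventually_gt_atTop 0] with n hn
      have hn' : (n : ℝ) ^ (-2 : ℝ) * (n : ℝ) ^ (2 : ℝ) = 1 := by
        rw [← Real.rpow_add (by exact_mod_cast hn)]
        simp
      have htn : t n = 2 ^ k * τ n + (2 - 2 ^ k * γ) + σ n := rfl
      rw [shiftRatio_mul]
      simp only [pow_succ]
      linear_combination (1 - shiftRatio t n) * hn' + 2 * (n : ℝ) ^ (-2 : ℝ) * htn
  obtain ⟨σ, E', hσ, hE', heq⟩ := main k hk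
  rw [heq]
  exact (hM k hk σ hσ).add hE' (by linarith)

/-! ### From the given expansion to the theorem. -/

theorem hasOrder_ratVal_log_div_rpow (r : RatFunc ℝ) (α : ℝ) (j : ℕ) :
    HasOrder j (-α) (fun n => ratVal r (Real.log n) / (n : ℝ) ^ α) := by
  refine ((hasOrder_ratVal_log r j).mul_le (hasOrder_natCast_rpow j (-α))
    (by linarith)).congr (.of_eq ?_)
  ext n
  rw [Real.rpow_neg (by positivity), div_eq_mul_inv]

theorem shiftRatio_eq_turanRatio (a : ℕ → ℝ) (n : ℕ) : shiftRatio a n = turanRatio a (n + 1) := rfl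

namespace HasRatioExpansion

variable {a : ℕ → ℝ} {m : ℕ} {α : Fin (m + 1) → ℝ} {r : Fin (m + 1) → RatFunc ℝ} {β : ℝ}

theorem pos_apply (h : HasRatioExpansion a α r β) (i : Fin (m + 1)) : 0 < α i :=
  h.pos.trans_le (h.strictMono.monotone (Fin.zero_le i))

theorem hasOrder_sub (h : HasRatioExpansion a α r β) :
    HasOrder 0 (-β) (fun n => turanRatio a n -
      (1 + ∑ i, ratVal (r i) (Real.log (n : ℝ)) / (n : ℝ) ^ (α i))) := fun ε hε => by
  refine h.isLittleO.isBigO.trans (IsBigO.trans (EventuallyEq.isBigO (.of_eq ?_))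
    (natCast_rpow_isBigO (show -β ≤ -β + ε by linarith)))
  ext n
  rw [Real.rpow_neg (by positivity), one_div]

theorem eventually_ne_zero (h : HasRatioExpansion a α r β) : ∀ᶠ n in atTop, a n ≠ 0 := by
  have hβ : 0 < β := (h.pos_apply _).trans h.last_lt
  have h1 := h.hasOrder_sub.tendsto_zero (by linarith)
  have h2 : Tendsto (fun n : ℕ => ∑ i, ratVal (r i) (Real.log (n : ℝ)) / (n : ℝ) ^ (α i)) atTop
      (nhds (∑ _i : Fin (m + 1), 0)) := tendsto_finsetSum _ fun i _ =>
    (hasOrder_ratVal_log_div_rpow (r i) (α i) 0).tendsto_zero (by linarith [h.pos_apply i])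
  have h3 := h1.add (h2.const_add 1)
  simp only [sub_add_cancel, Finset.sum_const_zero, add_zero, zero_add] at h3
  filter_upwards [h3.eventually_ne one_ne_zero] with n hn h0
  -- Division by zero yields `0`, so `a n = 0` would give ratio `0`, while the ratio tends to `1`.
  simp [turanRatio, h0] at hn

/-- The explicit part of `1 - shiftRatio a`, split into its leading term and the rest. -/
theorem exists_hasOrder_remainder (h : HasRatioExpansion a α r β) {δ : ℝ} (h1 : δ ≤ 1)
    (hδ : ∀ i ≠ 0, α 0 + δ ≤ α i) :
    ∃ E : ℕ → ℝ, (∀ j, HasOrder j (-α 0 - δ) E) ∧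
      HasOrder 0 (-β) (fun n => 1 - shiftRatio a n -
        ((n : ℝ) ^ (-α 0) * -ratVal (r 0) (Real.log n) + E n)) := by
  set T : Fin (m + 1) → ℕ → ℝ := fun i n => ratVal (r i) (Real.log n) / (n : ℝ) ^ α i with hT
  have hTo : ∀ i j, HasOrder j (-α i) (T i) := fun i j => hasOrder_ratVal_log_div_rpow _ _ j
  -- The ratio is taken at `n + 1`; moving the leading term back to `n` costs `Δ (T 0)`, of order
  -- `-α 0 - 1`.
  refine ⟨fun n => -Δ_[1] (T 0) n - ∑ i : Fin m, T i.succ (n + 1), fun j => ?_, ?_⟩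
  · refine (((hTo 0 (j + 1)).fwdDiff.mono (by linarith)).neg).sub (.sum _ fun i _ => ?_)
    exact (hTo i.succ (j + 1)).shift.mono (by linarith [hδ i.succ (Fin.succ_ne_zero i)])
  · refine h.hasOrder_sub.shift_zero.neg.congr (.of_eq ?_)
    ext n
    have e : (n : ℝ) ^ (-α 0) * -ratVal (r 0) (Real.log n) = -T 0 n := by
      rw [hT, Real.rpow_neg (by positivity)]
      ring
    rw [e, shiftRatio_eq_turanRatio]
    change -(turanRatio a (n + 1) - (1 + ∑ i, T i (n + 1))) = _
    rw [Fin.sum_univ_succ]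
    simp only [fwdDiff]
    ring

end HasRatioExpansion

theorem theorem3p2 (a : ℕ → ℝ) (m : ℕ) (α : Fin (m + 1) → ℝ)
    (r : Fin (m + 1) → RatFunc ℝ) (β : ℝ)
    (hu : HasRatioExpansion a α r β)
    (ℓ : ℕ) (hℓ : ℓ = ⌊α (Fin.last m) / α 0⌋₊)
    (h : (0 < α 0 ∧ α 0 < 2 ∧ ∀ᶠ x : ℝ in atTop, ratVal (r 0) x < 0) ∨
      (α 0 = 2 ∧ ∀ᶠ x : ℝ in atTop,
        ratVal (r 0) x < -2 + 1 / (2 : ℝ) ^ ((ℓ : ℤ) - 2))) :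
    IsAsympLogConcaveSeq ℓ a := by
  have hB : ℓ * α 0 < β := by
    have h1 : (ℓ : ℝ) ≤ α (Fin.last m) / α 0 :=
      hℓ ▸ Nat.floor_le (div_nonneg (hu.pos_apply _).le hu.pos.le)
    rw [le_div_iff₀ hu.pos] at h1
    exact h1.trans_lt hu.last_lt
  have hgap : ∀ᶠ δ : ℝ in nhdsWithin 0 (Set.Ioi 0), 0 < δ ∧ δ ≤ 1 ∧ ∀ i ≠ 0, α 0 + δ ≤ α i := by
    refine Filter.Eventually.and self_mem_nhdsWithin (nhdsWithin_le_nhds (Filter.Eventually.and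
      (ge_mem_nhds one_pos) (eventually_all.mpr fun i => ?_)))
    by_cases hi : i = 0
    · exact .of_forall fun _ h => absurd hi h
    · have : 0 < α i - α 0 := sub_pos.mpr (hu.strictMono (Fin.pos_iff_ne_zero.mpr hi))
      exact (ge_mem_nhds this).mono fun δ hδ _ => by linarith
  rcases h with ⟨h0, h2, hr⟩ | ⟨h2, hr⟩
  · obtain ⟨δ, ⟨hδ, hδ1, hgap⟩, hδα, hδ2⟩ := (hgap.and (nhdsWithin_le_nhds (Filter.Eventually.and
      (ge_mem_nhds h0) (ge_mem_nhds (sub_pos.mpr h2))))).exists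
    obtain ⟨E, hE, he⟩ := hu.exists_hasOrder_remainder hδ1 hgap
    obtain ⟨hpos, p, hτ, hv⟩ := neg_ratVal_log_sub_isLogSymbol (r 0) 0 (by simpa using hr)
    have hM := (posOrder_natCast_rpow (-α 0)).mul (posOrder_zero_add_add (σ := fun _ => 0) hτ hv
      hpos (fun _ => .zero) one_pos le_rfl)
    simp only [one_mul, add_zero, sub_zero] at hM
    exact isAsympLogConcaveSeq_of_posOrder h0 hB hu.eventually_ne_zero
      (fun k _ => posOrder_iterate_ratioStep hM hE hδ hδ1 hδα hδ2 k) he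
  · obtain ⟨δ, hδ, hδ1, hgap⟩ := hgap.exists
    obtain ⟨E, hE, he⟩ := hu.exists_hasOrder_remainder hδ1 hgap
    set γ : ℝ := 1 / (2 : ℝ) ^ ((ℓ : ℤ) - 2) with hγ
    obtain ⟨hpos, p, hτ, hv⟩ := neg_ratVal_log_sub_isLogSymbol (r 0) (2 - γ)
      (hr.mono fun x hx => by linarith)
    -- Equality holds at `k = ℓ - 1`, which explains the exponent `ℓ - 2`.
    have hk : ∀ k < ℓ, 2 ^ k * γ ≤ 2 := by
      intro k hk
      rw [hγ, mul_one_div, ← zpow_natCast, ← zpow_sub₀ two_ne_zero]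
      calc (2 : ℝ) ^ ((k : ℤ) - (ℓ - 2)) ≤ 2 ^ (1 : ℤ) :=
            zpow_le_zpow_right₀ one_le_two (by omega)
        _ = 2 := zpow_one 2
    rw [h2] at he hE
    refine isAsympLogConcaveSeq_of_posOrder hu.pos hB hu.eventually_ne_zero (fun k hkℓ => ?_) he
    have := posOrder_iterate_ratioStep_two hτ hv hpos hE hδ hδ1 (by positivity) hk hkℓ
    simp only [sub_add_cancel] at this
    rw [h2]
    simpa only [sub_add_cancel] using this
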